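/- For transfer matrices $X,Y$ let $\langle X,Y\rangle=\frac1{2\pi}\int_{-\pi}^{\pi}X(e^{i\omega})Y^*(e^{i\omega})\,d\omega$, where $^*$ denotes the conjugate transpose, and let $\Gamma_n(q)=[q^{-1}\ \cdots\ q^{-n}]^{\mathsf T}$. A scalar filter $F(q)=\sum_{k\ge0}f_kq^{-k}$ is exponentially stable if there are $C$ and $0<\lambda<1$ with $|f_k|<C\lambda^k$ for all $k\ge 0$. Let $F_j(q)=\sum_{k\ge0}f^{(j)}_kq^{-k}$, $j=1,\dots,7$, be exponentially stable filters with (real or) complex coefficients, let $m_f,m_l\in\mathbb N$, and let $$\Omega_n=\begin{bmatrix}F_1\Gamma_n&F_2\Gamma_n\\F_3\Gamma_n&F_2F_4\Gamma_n\end{bmatrix},\qquad \Psi_n=\begin{bmatrix}F_5^*\Gamma_n&0\end{bmatrix},\qquad \gamma=\begin{bmatrix}F_6\Gamma_{m_f}&0\\F_7\Gamma_{m_l}&0\end{bmatrix},$$ all evaluated at $q=e^{i\omega}$. Assume that $f^{(4)}_0\neq0$, that $F_3-F_1F_4$ and $F_5$ have causal inverses $(F_3-F_1F_4)^{-1}$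 and $F_5^{-1}$ (power series in $q^{-1}$) that are exponentially stable, and that there are $c>0$ and $\bar n$ such that the smallest singular value satisfies $\sigma_{\min}(\langle\Omega_n,\Omega_n\rangle)>c$ for all $n>\bar n$. Then for all sufficiently large $n$ the matrices $\langle\Omega_n,\Omega_n\rangle$ and $\langle\Psi_n,\Omega_n\rangle\langle\Omega_n,\Omega_n\rangle^{-1}\langle\Omega_n,\Psi_n\rangle$ are invertible, and $$\lim_{n\to\infty}\langle\gamma,\Psi_n\rangle\left[\langle\Psi_n,\Omega_n\rangle\langle\Omega_n,\Omega_n\rangle^{-1}\langle\Omega_n,\Psi_n\rangle\right]^{-1}\langle\Psi_n,\gamma\rangle=\langle\gamma,\gamma\rangle .$$ -/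

import Mathlib

open Filter Topology
open scoped PowerSeries

namespace GeometricVariance

noncomputable section

/-- A causal scalar filter `F(q) = ∑_{k ≥ 0} f_k q^{-k}` is represented by its impulse response
`(f_k)`, that is, by a formal power series in the backward shift `q^{-1}`.  It is exponentially
stable if `|f_k| < C λ^k` for all `k`, for some constants `C` and `0 < λ < 1`. -/
def ExpStable (F : ℂ⟦X⟧) : Prop :=
  ∃ C lam : ℝ, 0 < lam ∧ lam < 1 ∧ ∀ k : ℕ, ‖PowerSeries.coeff k F‖ < C * lam ^ k

/-- `F` has an inverse filter `F^{-1}` (causal, as a formal power series in `q^{-1}`), and this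
inverse is exponentially stable. -/
def HasExpStableInv (F : ℂ⟦X⟧) : Prop :=
  ∃ G : ℂ⟦X⟧, F * G = 1 ∧ ExpStable G

/-- Frequency response `F(e^{iω}) = ∑_{k ≥ 0} f_k e^{-iωk}`. -/
def freqResp (F : ℂ⟦X⟧) (ω : ℝ) : ℂ :=
  ∑' k : ℕ, PowerSeries.coeff k F * Complex.exp (-(Complex.I * ω * k))

/-- The delay vector `Γ_n(q) = [q^{-1} ⋯ q^{-n}]'` at `q = e^{iω}`. -/
def delayVec (n : ℕ) (ω : ℝ) (k : Fin n) : ℂ :=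
  Complex.exp (-(Complex.I * ω * ((k : ℕ) + 1)))

/-- `⟨X, Y⟩ = (1 / 2π) ∫_{-π}^{π} X(e^{iω}) Y(e^{iω})^* dω`, entry by entry. -/
def innerProd {ι κ l : Type*} [Fintype l] (X : ℝ → Matrix ι l ℂ) (Y : ℝ → Matrix κ l ℂ) :
    Matrix ι κ ℂ :=
  Matrix.of fun i j => (1 / (2 * Real.pi) : ℂ) *
    ∫ ω in (-Real.pi)..Real.pi, (X ω * (Y ω).conjTranspose) i j

/-- `Ω_n = [F₁ Γ_n, F₂ Γ_n; F₃ Γ_n, F₂ F₄ Γ_n]`, of size `2n × 2`. -/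
def Omega (F₁ F₂ F₃ F₄ : ℂ⟦X⟧) (n : ℕ) (ω : ℝ) : Matrix (Fin n ⊕ Fin n) (Fin 2) ℂ :=
  Matrix.of (Sum.elim
    (fun k => ![freqResp F₁ ω * delayVec n ω k, freqResp F₂ ω * delayVec n ω k])
    (fun k => ![freqResp F₃ ω * delayVec n ω k,
      freqResp F₂ ω * freqResp F₄ ω * delayVec n ω k]))

/-- `Ψ_n = [F₅^* Γ_n, 0]`, of size `n × 2`. -/
def Psi (F₅ : ℂ⟦X⟧) (n : ℕ) (ω : ℝ) : Matrix (Fin n) (Fin 2) ℂ :=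
  Matrix.of fun k => ![star (freqResp F₅ ω) * delayVec n ω k, 0]

/-- `γ = [F₆ Γ_{m_f}, 0; F₇ Γ_{m_l}, 0]`, of size `(m_f + m_l) × 2`. -/
def gam (F₆ F₇ : ℂ⟦X⟧) (mf ml : ℕ) (ω : ℝ) : Matrix (Fin mf ⊕ Fin ml) (Fin 2) ℂ :=
  Matrix.of (Sum.elim
    (fun k => ![freqResp F₆ ω * delayVec mf ω k, 0])
    (fun k => ![freqResp F₇ ω * delayVec ml ω k, 0]))

/-- The smallest singular value of a (nonempty) square matrix: singular values are listed in
decreasing order, starting from index `0`. -/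
def sigmaMin {ι : Type*} [Fintype ι] [DecidableEq ι] (A : Matrix ι ι ℂ) : ℝ :=
  (Matrix.toEuclideanLin A).singularValues (Fintype.card ι - 1)

/-- `⟨Ψ, Ω⟩ ⟨Ω, Ω⟩⁻¹ ⟨Ω, Ψ⟩`: the Gram matrix of the projections of the rows of `Ψ` onto the span
of the rows of `Ω`. -/
def innerProjection {ι κ l : Type*} [Fintype ι] [DecidableEq ι] [Fintype l]
    (Ψ : ℝ → Matrix κ l ℂ) (Ω : ℝ → Matrix ι l ℂ) : Matrix κ κ ℂ :=
  innerProd Ψ Ω * (innerProd Ω Ω)⁻¹ * innerProd Ω Ψ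

end

end GeometricVariance

open GeometricVariance

/-! By Parseval, `innerProd` of transfer matrices with causal rows is a Gram matrix in two copies of
ℓ², where filters act as power series in the shift. Let u_k be the k-th delay in the first channel,
V_n the span of the first n of them, P_n the projection onto the row span of Ω_n, and K_n the Gram
matrix of P_n compressed to V_n. Against causal rows, Ψ_n acts as T_n times the u_k, with T_n a
triangular Toeplitz matrix that is invertible because F₅ has a causal inverse (`innerProd_Psi_eq`,
`isUnit_toeplitz`). So the inner projection is T_n K_n T_n^*, the factors T_n cancel, and F₅
disappears from the limit.

What remains is a Galerkin scheme (`tendsto_crossGram_mul_inv_mul`): the z_n in V_n for which P_n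
z_n and a row g of γ have equal inner products with all of V_n converges to g, provided P_n is
bounded below on V_n uniformly in n and P_n g → g. Both facts come from `omegaApprox`: to produce
(x, 0) from the rows of Ω, solve a + F₄ b = 0 and (F₃ - F₁F₄) b = x, then truncate. Causality keeps
the first n entries of the first channel exact. The singular value bound serves only to invert ⟨Ω_n,
Ω_n⟩. -/

namespace GeometricVariance
noncomputable section

/-! ### Square-summable sequences, shift and truncation -/

/-- The Hilbert space of square-summable sequences, the coordinate space of the strictly causal
square-integrable signals: the `k`-th unit vector stands for `q^{-(k+1)}`. -/
abbrev SeqL2 : Type := lp (fun _ : ℕ => ℂ) 2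

def unitVec (k : ℕ) : SeqL2 := lp.single 2 k 1

lemma inner_unitVec_left (k : ℕ) (v : SeqL2) : inner ℂ (unitVec k) v = v k := by
  simp [unitVec, lp.inner_single_left]

lemma unitVec_apply (k i : ℕ) : unitVec k i = if k = i then 1 else 0 := by
  simp [unitVec, lp.single_apply, Pi.single_apply, eq_comm]

lemma inner_unitVec_unitVec (k i : ℕ) :
    inner ℂ (unitVec k) (unitVec i) = if k = i then (1 : ℂ) else 0 := by
  rw [inner_unitVec_left, unitVec_apply]; simp [eq_comm]

instance : Nontrivial SeqL2 :=
  ⟨unitVec 0, 0, fun h => by simpa [h] using inner_unitVec_unitVec 0 0⟩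

lemma orthonormal_unitVec : Orthonormal ℂ unitVec :=
  orthonormal_iff_ite.2 inner_unitVec_unitVec

lemma hasSum_unitVec (v : SeqL2) : HasSum (fun i => v i • unitVec i) v := by
  have h := lp.hasSum_single (p := 2) (by simp) v
  convert h using 2 with i
  simp [unitVec, ← lp.single_smul]

/-- The backward shift operator `q^{-1}` on strictly causal signals. -/
def shift : SeqL2 →L[ℂ] SeqL2 :=
  ((orthonormal_unitVec.comp Nat.succ Nat.succ_injective).orthogonalFamily.linearIsometry
    ).toContinuousLinearMap

lemma norm_shift_le : ‖shift‖ ≤ 1 := LinearIsometry.norm_toContinuousLinearMap_le _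

lemma shift_unitVec (k : ℕ) : shift (unitVec k) = unitVec (k + 1) := by
  simp [shift, unitVec]

lemma shift_pow_unitVec (a k : ℕ) : (shift ^ a) (unitVec k) = unitVec (k + a) := by
  induction a with
  | zero => simp
  | succ a ih => rw [pow_succ', mul_apply_eq_comp, ih, shift_unitVec]; rfl

lemma hasSum_clm_apply {E : Type*} [NormedAddCommGroup E] [NormedSpace ℂ E] (A : SeqL2 →L[ℂ] E)
    (v : SeqL2) : HasSum (fun i => v i • A (unitVec i)) (A v) := by
  simpa using A.hasSum (hasSum_unitVec v)

/-- The signals of delay greater than `n`. -/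
def VanishBelow (n : ℕ) (v : SeqL2) : Prop := ∀ i < n, v i = 0

lemma VanishBelow.map_of_unitVec {n : ℕ} {A : SeqL2 →L[ℂ] SeqL2}
    (hA : ∀ k, n ≤ k → VanishBelow n (A (unitVec k))) {v : SeqL2} (hv : VanishBelow n v) :
    VanishBelow n (A v) := by
  intro i hi
  have h := (hasSum_clm_apply A v).mapL (innerSL ℂ (unitVec i))
  simp only [innerSL_apply_apply, inner_smul_right, inner_unitVec_left] at h
  refine h.unique ?_
  convert hasSum_zero with k
  rcases lt_or_ge k n with hk | hk
  · simp [hv k hk]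
  · simp [hA k hk i hi]

/-- Projection onto the first `n` coordinates. -/
def trunc (n : ℕ) : SeqL2 →L[ℂ] SeqL2 :=
  ∑ i ∈ Finset.range n, (innerSL ℂ (unitVec i)).smulRight (unitVec i)

lemma trunc_apply (n : ℕ) (v : SeqL2) :
    trunc n v = ∑ i ∈ Finset.range n, v i • unitVec i := by
  simp [trunc, inner_unitVec_left]

lemma trunc_apply_apply (n : ℕ) (v : SeqL2) (i : ℕ) :
    trunc n v i = if i < n then v i else 0 := by
  rw [trunc_apply, ← inner_unitVec_left, inner_sum]
  simp [inner_smul_right, inner_unitVec_unitVec]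

lemma norm_trunc_le (n : ℕ) : ‖trunc n‖ ≤ 1 := by
  refine ContinuousLinearMap.opNorm_le_bound _ zero_le_one fun v => ?_
  have h1 := lp.sum_rpow_le_norm_rpow (p := 2) (by simp) v (Finset.range n)
  have h2 := lp.norm_sum_single (p := 2) (by simp) (fun i => v i) (Finset.range n)
  have h3 : ∑ i ∈ Finset.range n, lp.single (E := fun _ : ℕ => ℂ) 2 i (v i) = trunc n v := by
    rw [trunc_apply]
    refine Finset.sum_congr rfl fun i _ => ?_
    simp [unitVec, ← lp.single_smul]
  rw [h3] at h2
  rw [← h2] at h1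
  simp only [ENNReal.toReal_ofNat, Real.rpow_ofNat] at h1
  simpa using (pow_le_pow_iff_left₀ (norm_nonneg _) (norm_nonneg _) two_ne_zero).1 h1

lemma tendsto_trunc (v : SeqL2) : Tendsto (fun n => trunc n v) atTop (𝓝 v) := by
  simpa only [trunc_apply] using (hasSum_unitVec v).tendsto_sum_nat

lemma tendsto_trunc_of_tendsto {v : ℕ → SeqL2} {a : SeqL2} (h : Tendsto v atTop (𝓝 a)) :
    Tendsto (fun n => trunc n (v n)) atTop (𝓝 a) := by
  have h1 : Tendsto (fun n => trunc n (v n - a)) atTop (𝓝 0) := by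
    refine squeeze_zero_norm (fun n => ?_) (tendsto_iff_norm_sub_tendsto_zero.1 h)
    simpa using (trunc n).le_of_opNorm_le (norm_trunc_le n) (v n - a)
  simpa using h1.add (tendsto_trunc a)

lemma trunc_eq_self_iff {n : ℕ} {v : SeqL2} :
    trunc n v = v ↔ ∀ i, n ≤ i → v i = 0 := by
  constructor
  · intro h i hi
    rw [← h, trunc_apply_apply, if_neg (by omega)]
  · intro h
    ext i
    rw [trunc_apply_apply]
    split_ifs with hi
    · rfl
    · exact (h i (by omega)).symm

lemma trunc_eq_zero {n : ℕ} {v : SeqL2} (h : VanishBelow n v) : trunc n v = 0 := by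
  rw [trunc_apply]
  exact Finset.sum_eq_zero fun i hi => by rw [h i (Finset.mem_range.1 hi), zero_smul]

lemma vanishBelow_sub_trunc (n : ℕ) (v : SeqL2) : VanishBelow n (v - trunc n v) := by
  intro i hi
  simp [trunc_apply_apply, hi]

/-! ### Absolutely summable filters as operators -/

/-- Absolute summability of the impulse response. -/
def AbsSummable (F : ℂ⟦X⟧) : Prop := Summable fun k => ‖PowerSeries.coeff k F‖

lemma ExpStable.absSummable {F : ℂ⟦X⟧} (h : ExpStable F) : AbsSummable F := by
  obtain ⟨C, l, h0, h1, h⟩ := h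
  exact Summable.of_nonneg_of_le (fun _ => norm_nonneg _) (fun k => (h k).le)
    ((summable_geometric_of_lt_one h0.le h1).mul_left C)

lemma AbsSummable.sub {F G : ℂ⟦X⟧} (hF : AbsSummable F) (hG : AbsSummable G) :
    AbsSummable (F - G) :=
  Summable.of_nonneg_of_le (fun _ => norm_nonneg _)
    (fun k => by simpa using norm_sub_le _ _) (Summable.add hF hG)

/-- The value of a power series at an element of a Banach algebra. -/
def evalAt {R : Type*} [NormedRing R] [NormedAlgebra ℂ R] (s : R) (F : ℂ⟦X⟧) : R :=
  ∑' k : ℕ, PowerSeries.coeff k F • s ^ k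

section evalAt
variable {R : Type*} [NormedRing R] [NormOneClass R] [NormedAlgebra ℂ R] {s : R}

lemma norm_coeff_smul_pow_le (hs : ‖s‖ ≤ 1) (F : ℂ⟦X⟧) (k : ℕ) :
    ‖PowerSeries.coeff k F • s ^ k‖ ≤ ‖PowerSeries.coeff k F‖ := by
  rw [norm_smul]
  exact mul_le_of_le_one_right (norm_nonneg _)
    ((norm_pow_le _ _).trans (pow_le_one₀ (norm_nonneg _) hs))

lemma AbsSummable.summable_norm (hs : ‖s‖ ≤ 1) {F : ℂ⟦X⟧} (hF : AbsSummable F) :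
    Summable fun k => ‖PowerSeries.coeff k F • s ^ k‖ :=
  Summable.of_nonneg_of_le (fun _ => norm_nonneg _) (norm_coeff_smul_pow_le hs F) hF

variable [CompleteSpace R]

lemma AbsSummable.hasSum_evalAt (hs : ‖s‖ ≤ 1) {F : ℂ⟦X⟧} (hF : AbsSummable F) :
    HasSum (fun k => PowerSeries.coeff k F • s ^ k) (evalAt s F) :=
  (hF.summable_norm hs).of_norm.hasSum

/-- Cauchy product. The Banach algebra setting covers both uses: `shift` for operators and the
unimodular number `unitDelay ω` for frequency responses. -/
lemma evalAt_mul (hs : ‖s‖ ≤ 1) {F G : ℂ⟦X⟧} (hF : AbsSummable F) (hG : AbsSummable G) :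
    evalAt s (F * G) = evalAt s F * evalAt s G := by
  unfold evalAt
  rw [tsum_mul_tsum_eq_tsum_sum_antidiagonal_of_summable_norm (hF.summable_norm hs)
    (hG.summable_norm hs)]
  refine tsum_congr fun n => ?_
  rw [PowerSeries.coeff_mul, Finset.sum_smul]
  refine Finset.sum_congr rfl fun p hp => ?_
  rw [← Finset.HasAntidiagonal.mem_antidiagonal.1 hp, pow_add, smul_mul_smul_comm]

lemma evalAt_sub (hs : ‖s‖ ≤ 1) {F G : ℂ⟦X⟧} (hF : AbsSummable F) (hG : AbsSummable G) :
    evalAt s (F - G) = evalAt s F - evalAt s G := by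
  have h := (hF.hasSum_evalAt hs).sub (hG.hasSum_evalAt hs)
  refine ((hF.sub hG).hasSum_evalAt hs).unique ?_
  simpa [sub_smul] using h

lemma evalAt_one {R : Type*} [NormedRing R] [NormedAlgebra ℂ R] {s : R} : evalAt s 1 = 1 := by
  unfold evalAt
  rw [tsum_eq_single 0]
  · simp
  · intro k hk
    simp [PowerSeries.coeff_one, hk]

end evalAt

lemma AbsSummable.mul {F G : ℂ⟦X⟧} (hF : AbsSummable F) (hG : AbsSummable G) :
    AbsSummable (F * G) := by
  unfold AbsSummable
  simp only [PowerSeries.coeff_mul]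
  exact summable_norm_sum_mul_antidiagonal_of_summable_norm
    (f := fun k => PowerSeries.coeff k F) (g := fun k => PowerSeries.coeff k G) hF hG

/-- Filtering by `F`, as an operator on strictly causal signals. -/
def filterOp (F : ℂ⟦X⟧) : SeqL2 →L[ℂ] SeqL2 := evalAt shift F

lemma AbsSummable.hasSum_filterOp_apply {F : ℂ⟦X⟧} (hF : AbsSummable F) (v : SeqL2) :
    HasSum (fun a => PowerSeries.coeff a F • (shift ^ a) v) (filterOp F v) :=
  (hF.hasSum_evalAt norm_shift_le).mapL (ContinuousLinearMap.apply ℂ SeqL2 v)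

lemma filterOp_mul_apply {F G : ℂ⟦X⟧} (hF : AbsSummable F) (hG : AbsSummable G) (v : SeqL2) :
    filterOp (F * G) v = filterOp F (filterOp G v) := by
  rw [filterOp, evalAt_mul norm_shift_le hF hG]; rfl

lemma filterOp_sub_apply {F G : ℂ⟦X⟧} (hF : AbsSummable F) (hG : AbsSummable G) (v : SeqL2) :
    filterOp (F - G) v = filterOp F v - filterOp G v := by
  rw [filterOp, evalAt_sub norm_shift_le hF hG]; rfl

lemma filterOp_apply_apply_of_mul_eq_one {F G : ℂ⟦X⟧} (hF : AbsSummable F) (hG : AbsSummable G)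
    (h : F * G = 1) (v : SeqL2) : filterOp F (filterOp G v) = v := by
  rw [← filterOp_mul_apply hF hG, h, filterOp, evalAt_one]; rfl

lemma AbsSummable.vanishBelow_filterOp {F : ℂ⟦X⟧} (hF : AbsSummable F) {n : ℕ} {v : SeqL2}
    (hv : VanishBelow n v) : VanishBelow n (filterOp F v) := by
  refine VanishBelow.map_of_unitVec (fun k hk i hi => ?_) hv
  have h := (hF.hasSum_filterOp_apply (unitVec k)).mapL (innerSL ℂ (unitVec i))
  simp only [innerSL_apply_apply, inner_smul_right, shift_pow_unitVec,
    inner_unitVec_unitVec] at h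
  rw [← inner_unitVec_left]
  refine h.unique ?_
  convert hasSum_zero with a
  rw [if_neg (by omega), mul_zero]

/-- Causality as triangularity: inputs beyond time n cannot influence the first n outputs. This is
what makes finite sections of filters exact. -/
lemma AbsSummable.trunc_filterOp_trunc {F : ℂ⟦X⟧} (hF : AbsSummable F) (n : ℕ) (v : SeqL2) :
    trunc n (filterOp F (trunc n v)) = trunc n (filterOp F v) := by
  have h := trunc_eq_zero (hF.vanishBelow_filterOp (vanishBelow_sub_trunc n v))
  rw [map_sub, map_sub, sub_eq_zero] at h
  exact h.symm

/-! ### Frequency responses and Parseval's identity -/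

/-- The backward shift `q^{-1}` at `q = e^{iω}`. -/
def unitDelay (ω : ℝ) : ℂ := Complex.exp (-(Complex.I * ω))

lemma norm_unitDelay (ω : ℝ) : ‖unitDelay ω‖ = 1 := by
  simp [unitDelay, Complex.norm_exp]

lemma continuous_unitDelay : Continuous unitDelay := by
  unfold unitDelay; fun_prop

lemma delayVec_eq (n : ℕ) (ω : ℝ) (k : Fin n) : delayVec n ω k = unitDelay ω ^ ((k : ℕ) + 1) := by
  rw [delayVec, unitDelay, ← Complex.exp_nat_mul]
  congr 1
  push_cast
  ring

lemma freqResp_eq_evalAt (F : ℂ⟦X⟧) (ω : ℝ) : freqResp F ω = evalAt (unitDelay ω) F := by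
  refine tsum_congr fun k => ?_
  rw [smul_eq_mul, unitDelay, ← Complex.exp_nat_mul]
  congr 2
  ring

lemma freqResp_mul {F G : ℂ⟦X⟧} (hF : AbsSummable F) (hG : AbsSummable G) (ω : ℝ) :
    freqResp (F * G) ω = freqResp F ω * freqResp G ω := by
  simp only [freqResp_eq_evalAt]
  exact evalAt_mul (norm_unitDelay ω).le hF hG

lemma AbsSummable.continuous_freqResp {F : ℂ⟦X⟧} (hF : AbsSummable F) :
    Continuous (freqResp F) := by
  simp only [funext (freqResp_eq_evalAt F), evalAt]
  have := continuous_unitDelay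
  exact continuous_tsum (fun k => by fun_prop) hF
    fun k ω => norm_coeff_smul_pow_le (norm_unitDelay ω).le F k

/-- The normalized inner product of scalar functions on `[-π, π]`. -/
def bracket (f g : ℝ → ℂ) : ℂ :=
  (1 / (2 * Real.pi) : ℂ) * ∫ ω in (-Real.pi)..Real.pi, f ω * star (g ω)

lemma star_bracket (f g : ℝ → ℂ) : star (bracket f g) = bracket g f := by
  simp only [bracket, star_mul', RCLike.star_def, ← intervalIntegral.intervalIntegral_conj]
  simp [mul_comm, map_ofNat]

lemma bracket_unitDelay_pow (a b : ℕ) :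
    bracket (fun ω => unitDelay ω ^ a) (fun ω => unitDelay ω ^ b) = if a = b then 1 else 0 := by
  have hpi : (Real.pi : ℂ) ≠ 0 := by exact_mod_cast Real.pi_ne_zero
  have key : ∀ ω : ℝ, unitDelay ω ^ a * star (unitDelay ω ^ b)
      = Complex.exp (Complex.I * ((b : ℂ) - a) * ω) := by
    intro ω
    simp only [unitDelay, RCLike.star_def, ← Complex.exp_conj, ← Complex.exp_nat_mul,
      ← Complex.exp_add]
    congr 1
    simp
    ring
  simp only [bracket, key]
  split_ifs with hab
  · subst hab
    simp
    field_simp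
    norm_num
  · have hc : Complex.I * ((b : ℂ) - a) ≠ 0 := by
      refine mul_ne_zero Complex.I_ne_zero (sub_ne_zero.2 ?_)
      exact_mod_cast (Ne.symm hab)
    rw [integral_exp_mul_complex hc]
    have : Complex.exp (Complex.I * ((b : ℂ) - a) * (Real.pi : ℝ))
        = Complex.exp (Complex.I * ((b : ℂ) - a) * ((-Real.pi : ℝ) : ℂ)) := by
      rw [Complex.exp_eq_exp_iff_exists_int]
      refine ⟨(b : ℤ) - a, ?_⟩
      push_cast
      ring
    rw [this, sub_self, zero_div, mul_zero]

/-- Dominated convergence, with the summable coefficients as majorant; it reduces Parseval to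
monomials, one filter at a time. -/
lemma AbsSummable.hasSum_bracket {F : ℂ⟦X⟧} (hF : AbsSummable F) {h g : ℝ → ℂ}
    (hh : Continuous h) (hg : Continuous g) :
    HasSum (fun a => PowerSeries.coeff a F * bracket (fun ω => unitDelay ω ^ a * h ω) g)
      (bracket (fun ω => freqResp F ω * h ω) g) := by
  have hb : Continuous fun ω => ‖h ω * star (g ω)‖ := by fun_prop
  have := intervalIntegral.hasSum_integral_of_dominated_convergence
    (μ := MeasureTheory.volume) (a := -Real.pi) (b := Real.pi)
    (F := fun a ω => PowerSeries.coeff a F * (unitDelay ω ^ a * h ω * star (g ω)))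
    (f := fun ω => freqResp F ω * h ω * star (g ω))
    (fun a ω => ‖PowerSeries.coeff a F‖ * ‖h ω * star (g ω)‖)
    (fun a => by
      have := continuous_unitDelay
      exact Continuous.aestronglyMeasurable (by fun_prop))
    (fun a => Eventually.of_forall fun ω _ => by
      simp [norm_unitDelay])
    (Eventually.of_forall fun ω _ => Summable.mul_right _ hF)
    (by
      simp only [tsum_mul_right]
      exact (hb.const_mul _ ).intervalIntegrable _ _)
    (Eventually.of_forall fun ω _ => by
      have h1 := (hF.hasSum_evalAt (norm_unitDelay ω).le).mul_right (h ω * star (g ω))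
      rw [← freqResp_eq_evalAt] at h1
      simpa only [smul_eq_mul, mul_assoc] using h1)
  simp only [intervalIntegral.integral_const_mul] at this
  have h2 := this.mul_left (1 / (2 * Real.pi) : ℂ)
  simpa only [bracket, mul_left_comm] using h2

lemma bracket_filtered_unitDelay_pow {G : ℂ⟦X⟧} (hG : AbsSummable G) (j m : ℕ) :
    bracket (fun ω => freqResp G ω * unitDelay ω ^ (j + 1)) (fun ω => unitDelay ω ^ (m + 1))
      = inner ℂ (unitVec m) (filterOp G (unitVec j)) := by
  have h1 := hG.hasSum_bracket (h := fun ω => unitDelay ω ^ (j + 1))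
    (g := fun ω => unitDelay ω ^ (m + 1)) (continuous_unitDelay.pow _) (continuous_unitDelay.pow _)
  have h2 := (hG.hasSum_filterOp_apply (unitVec j)).mapL (innerSL ℂ (unitVec m))
  rw [innerSL_apply_apply] at h2
  refine h1.unique (Eq.subst (motive := fun f => HasSum f _) (funext fun a => Eq.symm ?_) h2)
  simp only [← pow_add, bracket_unitDelay_pow, innerSL_apply_apply, inner_smul_right,
    shift_pow_unitVec, inner_unitVec_unitVec]
  congr 2
  simp only [eq_iff_iff]
  omega

/-- Parseval's identity for filtered delays. -/
lemma bracket_filtered_delays {F G : ℂ⟦X⟧} (hF : AbsSummable F) (hG : AbsSummable G) (k j : ℕ) :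
    bracket (fun ω => freqResp F ω * unitDelay ω ^ (k + 1))
      (fun ω => freqResp G ω * unitDelay ω ^ (j + 1))
      = inner ℂ (filterOp G (unitVec j)) (filterOp F (unitVec k)) := by
  have h1 := hF.hasSum_bracket (h := fun ω => unitDelay ω ^ (k + 1))
    (g := fun ω => freqResp G ω * unitDelay ω ^ (j + 1)) (continuous_unitDelay.pow _)
    (hG.continuous_freqResp.mul (continuous_unitDelay.pow (j + 1)))
  have h2 := (hF.hasSum_filterOp_apply (unitVec k)).mapL (innerSL ℂ (filterOp G (unitVec j)))
  rw [innerSL_apply_apply] at h2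
  refine h1.unique (Eq.subst (motive := fun f => HasSum f _) (funext fun a => Eq.symm ?_) h2)
  rw [innerSL_apply_apply, inner_smul_right, shift_pow_unitVec,
    ← inner_conj_symm, ← bracket_filtered_unitDelay_pow hG, ← RCLike.star_def, star_bracket]
  simp only [← pow_add, show a + (k + 1) = k + a + 1 by omega]

/-- A filter conjugated on one side can be moved to the other side. -/
lemma bracket_star_filtered {F G : ℂ⟦X⟧} (hF : AbsSummable F) (hG : AbsSummable G) (k j : ℕ) :
    bracket (fun ω => star (freqResp F ω) * unitDelay ω ^ (k + 1))
      (fun ω => freqResp G ω * unitDelay ω ^ (j + 1))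
      = inner ℂ (filterOp F (filterOp G (unitVec j))) (unitVec k) := by
  rw [← filterOp_mul_apply hF hG, ← inner_conj_symm, ← bracket_filtered_unitDelay_pow (hF.mul hG),
    ← RCLike.star_def, star_bracket]
  unfold bracket
  congr 1
  refine intervalIntegral.integral_congr fun ω _ => ?_
  simp only [freqResp_mul hF hG, star_mul']
  ring

lemma innerProd_fin_two_apply {ι κ : Type*} (X : ℝ → Matrix ι (Fin 2) ℂ)
    (Y : ℝ → Matrix κ (Fin 2) ℂ) (i : ι) (j : κ) (hX : ∀ l, Continuous fun ω => X ω i l)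
    (hY : ∀ l, Continuous fun ω => Y ω j l) :
    innerProd X Y i j = bracket (fun ω => X ω i 0) (fun ω => Y ω j 0)
      + bracket (fun ω => X ω i 1) (fun ω => Y ω j 1) := by
  simp only [innerProd, Matrix.of_apply, Matrix.mul_apply, Fin.sum_univ_two,
    Matrix.conjTranspose_apply, bracket]
  rw [intervalIntegral.integral_add, mul_add]
  · exact ((hX 0).mul (hY 0).star).intervalIntegrable _ _
  · exact ((hX 1).mul (hY 1).star).intervalIntegrable _ _

lemma innerProd_conjTranspose {ι κ l : Type*} [Fintype l] (X : ℝ → Matrix ι l ℂ)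
    (Y : ℝ → Matrix κ l ℂ) : (innerProd X Y).conjTranspose = innerProd Y X := by
  ext i j
  simp only [innerProd, Matrix.conjTranspose_apply, Matrix.of_apply, star_mul', RCLike.star_def,
    ← intervalIntegral.intervalIntegral_conj]
  congr 1
  · simp [map_ofNat]
  · refine intervalIntegral.integral_congr fun ω _ => ?_
    simp [Matrix.mul_apply, mul_comm]

/-! ### Projected Gram matrices and Galerkin convergence -/

section Projection
variable {W : Type*} [NormedAddCommGroup W] [InnerProductSpace ℂ W]

/-- Cross Gram matrix, with the convention `⟨x, y⟩ = x y^*` (linear in the first argument). -/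
def crossGram {ι κ : Type*} (x : ι → W) (y : κ → W) : Matrix ι κ ℂ :=
  Matrix.of fun i j => inner ℂ (y j) (x i)

lemma crossGram_conjTranspose {ι κ : Type*} (x : ι → W) (y : κ → W) :
    (crossGram x y).conjTranspose = crossGram y x := by
  ext i j
  simp [crossGram]

variable (P : Submodule ℂ W) [P.HasOrthogonalProjection]

/-- Least squares: the Gram matrix of the projections onto the span of `w`. -/
lemma crossGram_starProjection {ι κ : Type*} [Fintype ι] [DecidableEq ι] (w : ι → W) (u : κ → W)
    (hP : P = Submodule.span ℂ (Set.range w)) (hA : IsUnit (crossGram w w)) :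
    crossGram u w * (crossGram w w)⁻¹ * crossGram w u
      = crossGram (fun k => P.starProjection (u k)) u := by
  have hA' := (Matrix.isUnit_iff_isUnit_det _).1 hA
  set c := crossGram u w * (crossGram w w)⁻¹ with hc
  have hcA : c * crossGram w w = crossGram u w := by
    rw [hc, Matrix.nonsing_inv_mul_cancel_right _ _ hA']
  -- The rows of `c` solve the normal equations `hcA`, so the residual is orthogonal to every `w j`.
  have hproj : ∀ k, P.starProjection (u k) = ∑ i, c k i • w i := by
    intro k
    apply Submodule.eq_starProjection_of_mem_of_inner_eq_zero
    · rw [hP]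
      exact Submodule.sum_mem _ fun i _ => Submodule.smul_mem _ _ (Submodule.subset_span ⟨i, rfl⟩)
    · intro x hx
      rw [hP] at hx
      induction hx using Submodule.span_induction with
      | mem x hx =>
        obtain ⟨j, rfl⟩ := hx
        have h := congrFun (congrFun hcA k) j
        rw [Matrix.mul_apply] at h
        rw [← inner_conj_symm, map_eq_zero, inner_sub_right, inner_sum, sub_eq_zero]
        simpa [crossGram, inner_smul_right] using h.symm
      | zero => simp
      | add x y _ _ hx hy => rw [inner_add_right, hx, hy, add_zero]
      | smul a x _ hx => rw [inner_smul_right, hx, mul_zero]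
  ext k l
  simp [crossGram, hproj, Matrix.mul_apply]

variable {P}

lemma re_inner_self_starProjection (v : W) :
    RCLike.re (inner ℂ v (P.starProjection v)) = ‖P.starProjection v‖ ^ 2 := by
  rw [inner_re_symm, Submodule.re_inner_starProjection_eq_normSq]
  rfl

/-- A left null vector gives a combination z of the `u k` with ‖Pz‖² = ⟨z, Pz⟩ = 0; the lower bound
then forces z = 0. -/
lemma isUnit_crossGram_starProjection {κ : Type*} [Fintype κ] [DecidableEq κ] {u : κ → W}
    (hu : LinearIndependent ℂ u) {δ : ℝ} (hδ : 0 < δ)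
    (hlow : ∀ x ∈ Submodule.span ℂ (Set.range u), δ * ‖x‖ ≤ ‖P.starProjection x‖) :
    IsUnit (crossGram (fun k => P.starProjection (u k)) u) := by
  rw [← Matrix.vecMul_injective_iff_isUnit]
  refine (injective_iff_map_eq_zero
    (Matrix.vecMulLinear (crossGram (fun k => P.starProjection (u k)) u))).2 ?_
  intro r hr
  set z := ∑ k, r k • u k with hz
  have hzmem : z ∈ Submodule.span ℂ (Set.range u) :=
    Submodule.sum_mem _ fun i _ => Submodule.smul_mem _ _ (Submodule.subset_span ⟨i, rfl⟩)
  have h1 : ∀ l, inner ℂ (u l) (P.starProjection z) = 0 := by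
    intro l
    have := congrFun hr l
    simpa [Matrix.vecMul, dotProduct, crossGram, hz, inner_sum, inner_smul_right] using this
  have h2 : inner ℂ z (P.starProjection z) = 0 := by
    have : inner ℂ (∑ k, r k • u k) (P.starProjection z) = 0 := by
      simp only [sum_inner, inner_smul_left, h1, mul_zero, Finset.sum_const_zero]
    exact this
  have h3 : P.starProjection z = 0 := by
    have := re_inner_self_starProjection (P := P) z
    rw [h2] at this
    simpa using this.symm
  have h4 : ‖z‖ = 0 := by
    have := hlow z hzmem
    rw [h3, norm_zero] at this
    nlinarith [norm_nonneg z]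
  exact funext ((Fintype.linearIndependent_iff.1 hu) r (norm_eq_zero.1 h4))

/-- If `z` and `y` lie in a subspace on which the projection is bounded below, and the projections
of `z` and of `g` have the same component in this subspace, `z` is close to `y`. -/
lemma norm_sub_le_of_inner_starProjection_eq {V : Submodule ℂ W} {δ : ℝ} (hδ : 0 < δ)
    (hlow : ∀ x ∈ V, δ * ‖x‖ ≤ ‖P.starProjection x‖) {z y g : W} (hz : z ∈ V) (hy : y ∈ V)
    (h : ∀ v ∈ V, inner ℂ v (P.starProjection z) = inner ℂ v g) :
    ‖z - y‖ ≤ (δ ^ 2)⁻¹ * ‖g - P.starProjection y‖ := by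
  have hV := V.sub_mem hz hy
  have h1 := hlow _ hV
  -- The error `z - y` lies in `V`, so it is itself an admissible test vector.
  have h2 : inner ℂ (z - y) (P.starProjection (z - y))
      = inner ℂ (z - y) (g - P.starProjection y) := by
    rw [map_sub, inner_sub_right, inner_sub_right, h _ hV]
  have h3 : ‖P.starProjection (z - y)‖ ^ 2 ≤ ‖z - y‖ * ‖g - P.starProjection y‖ := by
    rw [← re_inner_self_starProjection, h2]
    exact re_inner_le_norm _ _
  have h4 : (δ * ‖z - y‖) ^ 2 ≤ ‖z - y‖ * ‖g - P.starProjection y‖ :=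
    (pow_le_pow_left₀ (by positivity) h1 2).trans h3
  rcases (norm_nonneg (z - y)).eq_or_lt with h0 | h0
  · rw [← h0]; positivity
  · rw [inv_mul_eq_div, le_div_iff₀ (by positivity)]
    nlinarith

end Projection

/-- Weighted Gram matrices along an increasing orthonormal family converge, provided that the
weights come from projections which are bounded below and converge strongly at the vectors `g`. -/
lemma tendsto_crossGram_mul_inv_mul {W : Type*} [NormedAddCommGroup W] [InnerProductSpace ℂ W]
    (P : ℕ → Submodule ℂ W) [∀ n, (P n).HasOrthogonalProjection]
    {u : ℕ → W} (hu : Orthonormal ℂ u) {δ : ℝ} (hδ : 0 < δ)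
    (hlow : ∀ n, ∀ x ∈ Submodule.span ℂ (Set.range fun k : Fin n => u k),
      δ * ‖x‖ ≤ ‖(P n).starProjection x‖)
    {ι : Type*} [Finite ι] (g : ι → W)
    (hgP : ∀ i, Tendsto (fun n => (P n).starProjection (g i)) atTop (𝓝 (g i)))
    (hgu : ∀ i, Tendsto (fun n => ∑ k ∈ Finset.range n, inner ℂ (u k) (g i) • u k) atTop
      (𝓝 (g i))) :
    Tendsto (fun n => crossGram g (fun k : Fin n => u k)
      * (crossGram (fun k : Fin n => (P n).starProjection (u k)) (fun k : Fin n => u k))⁻¹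
      * crossGram (fun k : Fin n => u k) g) atTop (𝓝 (crossGram g g)) := by
  set K := fun n : ℕ => crossGram (fun k : Fin n => (P n).starProjection (u k))
    (fun k : Fin n => u k) with hK
  have hunit : ∀ n, IsUnit (K n) := fun n => isUnit_crossGram_starProjection
    (hu.comp _ Fin.val_injective).linearIndependent hδ (hlow n)
  set r := fun n : ℕ => crossGram g (fun k : Fin n => u k) * (K n)⁻¹ with hr
  have hrK : ∀ n, r n * K n = crossGram g (fun k : Fin n => u k) := fun n => by
    rw [hr, Matrix.nonsing_inv_mul_cancel_right _ _ ((Matrix.isUnit_iff_isUnit_det _).1 (hunit n))]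
  -- The Galerkin solution: its coefficients are the `i`-th row of `r n`.
  set z := fun (i : ι) (n : ℕ) => ∑ k : Fin n, r n i k • u k with hz
  have hzmem : ∀ i n, z i n ∈ Submodule.span ℂ (Set.range fun k : Fin n => u k) := fun i n =>
    Submodule.sum_mem _ fun k _ => Submodule.smul_mem _ _ (Submodule.subset_span ⟨k, rfl⟩)
  set y := fun (i : ι) (n : ℕ) => ∑ k ∈ Finset.range n, inner ℂ (u k) (g i) • u k with hy
  have hymem : ∀ i n, y i n ∈ Submodule.span ℂ (Set.range fun k : Fin n => u k) := fun i n =>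
    Submodule.sum_mem _ fun k hk => Submodule.smul_mem _ _
      (Submodule.subset_span ⟨⟨k, Finset.mem_range.1 hk⟩, rfl⟩)
  have hzP : ∀ i n, ∀ v ∈ Submodule.span ℂ (Set.range fun k : Fin n => u k),
      inner ℂ v ((P n).starProjection (z i n)) = inner ℂ v (g i) := by
    intro i n v hv
    induction hv using Submodule.span_induction with
    | mem x hx =>
      obtain ⟨l, rfl⟩ := hx
      have := congrFun (congrFun (hrK n) i) l
      simpa [Matrix.mul_apply, hK, crossGram, hz, inner_sum, inner_smul_right] using this
    | zero => simp
    | add x y _ _ hx hy => rw [inner_add_left, hx, hy, inner_add_left]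
    | smul a x _ hx => rw [inner_smul_left, hx, inner_smul_left]
  have hzlim : ∀ i, Tendsto (z i) atTop (𝓝 (g i)) := by
    intro i
    -- Consistency: replacing `g i` by its truncation `y i n` costs nothing in the limit, since
    -- projections are contractions.
    have h1 : Tendsto (fun n => g i - (P n).starProjection (y i n)) atTop (𝓝 0) := by
      have h2 : Tendsto (fun n => (P n).starProjection (g i - y i n)) atTop (𝓝 0) := by
        refine squeeze_zero_norm
          (fun n => ?_) (by simpa using (tendsto_const_nhds (x := g i)).sub (hgu i) |>.norm)
        simpa using (P n).starProjection.le_of_opNorm_le (P n).starProjection_norm_le (g i - y i n)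
      have h3 := ((tendsto_const_nhds (x := g i)).sub (hgP i)).add h2
      simpa using h3
    have h4 : Tendsto (fun n => z i n - y i n) atTop (𝓝 0) := by
      refine squeeze_zero_norm (fun n => norm_sub_le_of_inner_starProjection_eq hδ (hlow n)
        (hzmem i n) (hymem i n) (hzP i n)) ?_
      simpa using h1.norm.const_mul (δ ^ 2)⁻¹
    simpa [hy] using h4.add (hgu i)
  refine tendsto_pi_nhds.2 fun i => tendsto_pi_nhds.2 fun j => ?_
  have : ∀ n, (r n * crossGram (fun k : Fin n => u k) g) i j = inner ℂ (g j) (z i n) := fun n => by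
    simp [Matrix.mul_apply, crossGram, hz]
  change Tendsto (fun n => (r n * crossGram (fun k : Fin n => u k) g) i j) atTop
    (𝓝 (inner ℂ (g j) (g i)))
  simp only [this]
  exact tendsto_const_nhds.inner (hzlim i)

/-! ### Two-channel signals and the row span of Ω -/

/-- Two-channel strictly causal signals. -/
abbrev PairL2 : Type := WithLp 2 (SeqL2 × SeqL2)

/-- The pair of two signals, as a continuous linear map. -/
def pairVec : SeqL2 × SeqL2 →L[ℂ] PairL2 :=
  (WithLp.prodContinuousLinearEquiv 2 ℂ SeqL2 SeqL2).symm

lemma inner_pairVec (a b c d : SeqL2) :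
    inner ℂ (pairVec (a, b)) (pairVec (c, d)) = inner ℂ a c + inner ℂ b d := by
  simp [pairVec, WithLp.prod_inner_apply]

/-- The signal `x` in the first channel. -/
def firstChannel : SeqL2 →L[ℂ] PairL2 := pairVec ∘L ContinuousLinearMap.inl ℂ SeqL2 SeqL2

lemma firstChannel_apply (x : SeqL2) : firstChannel x = pairVec (x, 0) := rfl

lemma inner_pairVec_firstChannel (a b x : SeqL2) :
    inner ℂ (pairVec (a, b)) (firstChannel x) = inner ℂ a x := by
  rw [firstChannel_apply, inner_pairVec, inner_zero_right, add_zero]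

lemma inner_firstChannel (x y : SeqL2) :
    inner ℂ (firstChannel x) (firstChannel y) = inner ℂ x y :=
  inner_pairVec_firstChannel x 0 y

lemma norm_firstChannel (x : SeqL2) : ‖firstChannel x‖ = ‖x‖ := by
  rw [@norm_eq_sqrt_re_inner ℂ, inner_firstChannel, ← @norm_eq_sqrt_re_inner ℂ]

lemma orthonormal_firstChannel_unitVec : Orthonormal ℂ fun k => firstChannel (unitVec k) := by
  rw [orthonormal_iff_ite]
  intro i j
  rw [inner_firstChannel, inner_unitVec_unitVec]

lemma inner_trunc (n : ℕ) (x y : SeqL2) : inner ℂ (trunc n x) y = inner ℂ x (trunc n y) := by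
  rw [trunc_apply, trunc_apply, sum_inner, inner_sum]
  refine Finset.sum_congr rfl fun i _ => ?_
  rw [inner_smul_left, inner_smul_right, inner_unitVec_left, ← inner_conj_symm x,
    inner_unitVec_left, mul_comm]

lemma sum_inner_firstChannel_smul (n : ℕ) (y : SeqL2) :
    ∑ k ∈ Finset.range n, inner ℂ (firstChannel (unitVec k)) (firstChannel y)
      • firstChannel (unitVec k) = firstChannel (trunc n y) := by
  simp only [trunc_apply, inner_firstChannel, inner_unitVec_left, map_sum, map_smul]

lemma exists_of_mem_span_firstChannel {n : ℕ} {x : PairL2}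
    (hx : x ∈ Submodule.span ℂ (Set.range fun k : Fin n => firstChannel (unitVec k))) :
    ∃ v, trunc n v = v ∧ firstChannel v = x := by
  induction hx using Submodule.span_induction with
  | mem x hx =>
    obtain ⟨k, rfl⟩ := hx
    refine ⟨unitVec k, trunc_eq_self_iff.2 fun i hi => ?_, rfl⟩
    rw [unitVec_apply, if_neg (by omega)]
  | zero => exact ⟨0, by simp, by simp⟩
  | add x y _ _ hx hy =>
    obtain ⟨v, hv, rfl⟩ := hx
    obtain ⟨w, hw, rfl⟩ := hy
    exact ⟨v + w, by rw [map_add, hv, hw], map_add _ _ _⟩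
  | smul a x _ hx =>
    obtain ⟨v, hv, rfl⟩ := hx
    exact ⟨a • v, by rw [map_smul, hv], map_smul _ _ _⟩

section OmegaRows
variable (F₁ F₂ F₃ F₄ : ℂ⟦X⟧)

/-- The map sending coefficient signals `(a, b)` to the combination of rows of `Ω` that they
define. -/
def omegaMap : SeqL2 × SeqL2 →L[ℂ] PairL2 :=
  pairVec ∘L (((filterOp F₁).coprod (filterOp F₃)).prod
    (filterOp F₂ ∘L (ContinuousLinearMap.id ℂ SeqL2).coprod (filterOp F₄)))

lemma omegaMap_apply (a b : SeqL2) : omegaMap F₁ F₂ F₃ F₄ (a, b)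
    = pairVec (filterOp F₁ a + filterOp F₃ b, filterOp F₂ (a + filterOp F₄ b)) := rfl

def omegaRow (n : ℕ) : Fin n ⊕ Fin n → PairL2 :=
  Sum.elim (fun k => omegaMap F₁ F₂ F₃ F₄ (unitVec k, 0))
    (fun k => omegaMap F₁ F₂ F₃ F₄ (0, unitVec k))

def omegaSpan (n : ℕ) : Submodule ℂ PairL2 :=
  Submodule.span ℂ (Set.range (omegaRow F₁ F₂ F₃ F₄ n))

instance (n : ℕ) : (omegaSpan F₁ F₂ F₃ F₄ n).HasOrthogonalProjection := by
  have : FiniteDimensional ℂ (omegaSpan F₁ F₂ F₃ F₄ n) :=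
    FiniteDimensional.span_of_finite ℂ (Set.finite_range _)
  infer_instance

lemma omegaMap_trunc_mem (n : ℕ) (a b : SeqL2) :
    omegaMap F₁ F₂ F₃ F₄ (trunc n a, trunc n b) ∈ omegaSpan F₁ F₂ F₃ F₄ n := by
  have h : ((trunc n a, trunc n b) : SeqL2 × SeqL2)
      = ∑ i ∈ Finset.range n, (a i • ((unitVec i, 0) : SeqL2 × SeqL2) + b i • (0, unitVec i)) := by
    rw [trunc_apply, trunc_apply]
    ext1
    · simp [Prod.fst_sum]
    · simp [Prod.snd_sum]
  rw [h, map_sum]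
  refine Submodule.sum_mem _ fun i hi => ?_
  rw [map_add, map_smul, map_smul]
  have hi := Finset.mem_range.1 hi
  exact Submodule.add_mem _
    (Submodule.smul_mem _ _ (Submodule.subset_span ⟨Sum.inl ⟨i, hi⟩, rfl⟩))
    (Submodule.smul_mem _ _ (Submodule.subset_span ⟨Sum.inr ⟨i, hi⟩, rfl⟩))

/-- The combination of rows of `Ω_n` that approximates the first-channel signal `x`, where `G` is
the inverse of `F₃ - F₁ F₄`. -/
def omegaApprox (G : ℂ⟦X⟧) (n : ℕ) (x : SeqL2) : PairL2 :=
  omegaMap F₁ F₂ F₃ F₄ (trunc n (-filterOp F₄ (trunc n (filterOp G x))),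
    trunc n (filterOp G x))

lemma omegaApprox_mem (G : ℂ⟦X⟧) (n : ℕ) (x : SeqL2) :
    omegaApprox F₁ F₂ F₃ F₄ G n x ∈ omegaSpan F₁ F₂ F₃ F₄ n :=
  omegaMap_trunc_mem _ _ _ _ _ _ _

/-- Truncations are contractions, so the constant does not depend on `n`. -/
lemma norm_omegaApprox_le (G : ℂ⟦X⟧) (n : ℕ) (x : SeqL2) :
    ‖omegaApprox F₁ F₂ F₃ F₄ G n x‖
      ≤ ‖omegaMap F₁ F₂ F₃ F₄‖ * ((‖filterOp F₄‖ + 1) * ‖filterOp G‖) * ‖x‖ := by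
  have ht : ∀ v, ‖trunc n v‖ ≤ ‖v‖ := fun v => by
    simpa using (trunc n).le_of_opNorm_le (norm_trunc_le n) v
  have hG : ‖trunc n (filterOp G x)‖ ≤ ‖filterOp G‖ * ‖x‖ :=
    (ht _).trans ((filterOp G).le_opNorm x)
  have hF : ‖trunc n (-filterOp F₄ (trunc n (filterOp G x)))‖
      ≤ ‖filterOp F₄‖ * (‖filterOp G‖ * ‖x‖) := by
    refine (ht _).trans ?_
    rw [norm_neg]
    exact ((filterOp F₄).le_opNorm _).trans (by gcongr)
  have h0 : 0 ≤ ‖filterOp G‖ * ‖x‖ := by positivity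
  have h1 : 0 ≤ ‖filterOp F₄‖ * (‖filterOp G‖ * ‖x‖) := by positivity
  refine ((omegaMap F₁ F₂ F₃ F₄).le_opNorm _).trans ?_
  rw [mul_assoc]
  gcongr
  -- The coefficient pair carries the sup norm; the factor ‖F₄‖ + 1 dominates both components.
  rw [Prod.norm_mk]
  refine max_le (hF.trans ?_) (hG.trans ?_) <;> nlinarith

variable {F₁ F₂ F₃ F₄} {G : ℂ⟦X⟧}

/-- Separates the combination a + F₄ b that drives the second channel; once it vanishes, only F₃ -
F₁F₄ acts on b. -/
lemma filterOp_add_filterOp (h₁ : AbsSummable F₁) (h₃ : AbsSummable F₃) (h₄ : AbsSummable F₄)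
    (a b : SeqL2) : filterOp F₁ a + filterOp F₃ b
      = filterOp F₁ (a + filterOp F₄ b) + filterOp (F₃ - F₁ * F₄) b := by
  rw [filterOp_sub_apply h₃ (h₁.mul h₄), filterOp_mul_apply h₁ h₄, map_add]
  abel

/-- The pairing sees only the first `n` entries of the first channel, and there truncating the
coefficients changes nothing. -/
lemma inner_omegaApprox (h₁ : AbsSummable F₁) (h₃ : AbsSummable F₃) (h₄ : AbsSummable F₄)
    (hG : AbsSummable G) (hinv : (F₃ - F₁ * F₄) * G = 1) {n : ℕ} {x : SeqL2}
    (hx : trunc n x = x) :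
    inner ℂ (omegaApprox F₁ F₂ F₃ F₄ G n x) (firstChannel x) = inner ℂ x x := by
  have hΔ := h₃.sub (h₁.mul h₄)
  rw [omegaApprox, omegaMap_apply, inner_pairVec_firstChannel]
  conv_lhs => rw [← hx, ← inner_trunc]
  rw [hx, filterOp_add_filterOp h₁ h₃ h₄, map_add, ← h₁.trunc_filterOp_trunc,
    hΔ.trunc_filterOp_trunc, filterOp_apply_apply_of_mul_eq_one hΔ hG hinv, hx]
  have htt : ∀ v, trunc n (trunc n v) = trunc n v := fun v =>
    trunc_eq_self_iff.2 fun i hi => by rw [trunc_apply_apply, if_neg (by omega)]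
  rw [map_add, htt, map_neg, neg_add_cancel, map_zero, map_zero, zero_add]

/-- The projection onto the rows of `Ω_n` is bounded below on the first `n` delays in the first
channel, uniformly in `n`. -/
lemma exists_le_norm_starProjection_omegaSpan (h₁ : AbsSummable F₁) (h₃ : AbsSummable F₃)
    (h₄ : AbsSummable F₄) (hG : AbsSummable G) (hinv : (F₃ - F₁ * F₄) * G = 1) :
    ∃ δ : ℝ, 0 < δ ∧ ∀ n,
      ∀ x ∈ Submodule.span ℂ (Set.range fun k : Fin n => firstChannel (unitVec k)),
        δ * ‖x‖ ≤ ‖(omegaSpan F₁ F₂ F₃ F₄ n).starProjection x‖ := by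
  set C := ‖omegaMap F₁ F₂ F₃ F₄‖ * ((‖filterOp F₄‖ + 1) * ‖filterOp G‖) with hC
  have hC0 : 0 ≤ C := by positivity
  refine ⟨(C + 1)⁻¹, by positivity, fun n x hx => ?_⟩
  obtain ⟨v, hv, rfl⟩ := exists_of_mem_span_firstChannel hx
  rw [norm_firstChannel, inv_mul_le_iff₀ (by positivity)]
  set p := (omegaSpan F₁ F₂ F₃ F₄ n).starProjection (firstChannel v)
  have h1 : ‖v‖ * ‖v‖ ≤ C * ‖v‖ * ‖p‖ := by
    -- The approximant is fixed by the projection, which can therefore be moved onto `firstChannel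
    -- v`.
    have h2 : inner ℂ v v = inner ℂ (omegaApprox F₁ F₂ F₃ F₄ G n v) p := by
      rw [← inner_omegaApprox (F₂ := F₂) h₁ h₃ h₄ hG hinv hv,
        ← Submodule.inner_starProjection_left_eq_right,
        Submodule.starProjection_eq_self_iff.2 (omegaApprox_mem _ _ _ _ _ _ _)]
    rw [← pow_two, ← inner_self_eq_norm_sq (𝕜 := ℂ) v, h2]
    exact (re_inner_le_norm _ _).trans
      (mul_le_mul_of_nonneg_right (norm_omegaApprox_le _ _ _ _ _ _ _) (norm_nonneg _))
  rcases (norm_nonneg v).eq_or_lt with h0 | h0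
  · rw [← h0]; positivity
  · have h3 : ‖v‖ ≤ C * ‖p‖ := by
      refine le_of_mul_le_mul_left ?_ h0
      linarith
    nlinarith [norm_nonneg p]

lemma tendsto_omegaApprox (h₁ : AbsSummable F₁) (h₃ : AbsSummable F₃) (h₄ : AbsSummable F₄)
    (hG : AbsSummable G) (hinv : (F₃ - F₁ * F₄) * G = 1) (x : SeqL2) :
    Tendsto (fun n => omegaApprox F₁ F₂ F₃ F₄ G n x) atTop (𝓝 (firstChannel x)) := by
  have hb := tendsto_trunc (filterOp G x)
  have ha := tendsto_trunc_of_tendsto (((filterOp F₄).continuous.tendsto _).comp hb).neg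
  have h := ((omegaMap F₁ F₂ F₃ F₄).continuous.tendsto _).comp (ha.prodMk_nhds hb)
  have hlim : firstChannel x
      = omegaMap F₁ F₂ F₃ F₄ (-filterOp F₄ (filterOp G x), filterOp G x) := by
    rw [omegaMap_apply, filterOp_add_filterOp h₁ h₃ h₄, neg_add_cancel, map_zero, map_zero,
      zero_add, filterOp_apply_apply_of_mul_eq_one (h₃.sub (h₁.mul h₄)) hG hinv, firstChannel_apply]
  rw [hlim]
  exact h

/-- The projection fixes the approximants and contracts the vanishing remainder. -/
lemma tendsto_starProjection_omegaSpan (h₁ : AbsSummable F₁) (h₃ : AbsSummable F₃)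
    (h₄ : AbsSummable F₄) (hG : AbsSummable G) (hinv : (F₃ - F₁ * F₄) * G = 1) (x : SeqL2) :
    Tendsto (fun n => (omegaSpan F₁ F₂ F₃ F₄ n).starProjection (firstChannel x)) atTop
      (𝓝 (firstChannel x)) := by
  have h := tendsto_omegaApprox (F₂ := F₂) h₁ h₃ h₄ hG hinv x
  have h1 : Tendsto (fun n => (omegaSpan F₁ F₂ F₃ F₄ n).starProjection
      (firstChannel x - omegaApprox F₁ F₂ F₃ F₄ G n x)) atTop (𝓝 0) := by
    refine squeeze_zero_norm (fun n => ?_)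
      (by simpa using ((tendsto_const_nhds (x := firstChannel x)).sub h).norm)
    simpa using (omegaSpan F₁ F₂ F₃ F₄ n).starProjection.le_of_opNorm_le
      (omegaSpan F₁ F₂ F₃ F₄ n).starProjection_norm_le
      (firstChannel x - omegaApprox F₁ F₂ F₃ F₄ G n x)
  have h2 := h1.add h
  simp only [map_sub, Submodule.starProjection_eq_self_iff.2
    (omegaApprox_mem F₁ F₂ F₃ F₄ G _ x), sub_add_cancel, zero_add] at h2
  exact h2

end OmegaRows

/-! ### The Toeplitz factor contributed by F₅ -/

section LowerToeplitz

/-- The matrix of the compression of the adjoint of `filterOp F` to the first `n` delays. -/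
def toeplitz (F : ℂ⟦X⟧) (n : ℕ) : Matrix (Fin n) (Fin n) ℂ :=
  Matrix.of fun k i => inner ℂ (filterOp F (unitVec i)) (unitVec k)

/-- The adjoint of a causal filter preserves the span of the first `n` delays, so the finite sum has
no tail. -/
lemma inner_filterOp_unitVec {F : ℂ⟦X⟧} (hF : AbsSummable F) {n : ℕ} (k : Fin n) (v : SeqL2) :
    inner ℂ (filterOp F v) (unitVec k) = ∑ i, toeplitz F n k i * inner ℂ v (unitVec i) := by
  have hk : trunc n (unitVec k) = unitVec k := trunc_eq_self_iff.2 fun i hi => by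
    rw [unitVec_apply, if_neg (by omega)]
  rw [← hk, ← inner_trunc, ← hF.trunc_filterOp_trunc, inner_trunc, hk, trunc_apply,
    Finset.sum_range]
  simp only [map_sum, map_smul, sum_inner, inner_smul_left, toeplitz, Matrix.of_apply]
  refine Finset.sum_congr rfl fun i _ => ?_
  rw [← inner_unitVec_left, inner_conj_symm, mul_comm]

/-- By triangularity the finite section of the inverse filter inverts the finite section exactly. -/
lemma isUnit_toeplitz {F G : ℂ⟦X⟧} (hF : AbsSummable F) (hG : AbsSummable G) (h : F * G = 1)
    (n : ℕ) : IsUnit (toeplitz F n) := by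
  refine IsUnit.of_mul_eq_one (toeplitz G n) ?_
  ext k j
  rw [Matrix.mul_apply]
  have := inner_filterOp_unitVec hF k (filterOp G (unitVec j))
  rw [filterOp_apply_apply_of_mul_eq_one hF hG h, inner_unitVec_unitVec] at this
  simp only [toeplitz, Matrix.of_apply] at this ⊢
  rw [← this, Matrix.one_apply]
  simp [Fin.ext_iff, eq_comm]

end LowerToeplitz

/-! ### Transfer matrices as families of vectors -/

section Representation

/-- The row `f` of a two-column transfer matrix consists of equally delayed causal filters with
coefficient signal `x`. -/
def Represents (f : ℝ → Fin 2 → ℂ) (x : PairL2) : Prop :=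
  ∃ (A B : ℂ⟦X⟧) (k : ℕ), AbsSummable A ∧ AbsSummable B ∧
    (∀ ω, f ω 0 = freqResp A ω * unitDelay ω ^ (k + 1)) ∧
    (∀ ω, f ω 1 = freqResp B ω * unitDelay ω ^ (k + 1)) ∧
    x = pairVec (filterOp A (unitVec k), filterOp B (unitVec k))

lemma Represents.continuous {f : ℝ → Fin 2 → ℂ} {x : PairL2} (h : Represents f x) (l : Fin 2) :
    Continuous fun ω => f ω l := by
  obtain ⟨A, B, k, hA, hB, h0, h1, -⟩ := h
  fin_cases l
  · simp only [Fin.zero_eta, h0]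
    exact hA.continuous_freqResp.mul (continuous_unitDelay.pow _)
  · simp only [Fin.mk_one, h1]
    exact hB.continuous_freqResp.mul (continuous_unitDelay.pow _)

lemma innerProd_eq_crossGram {ι κ : Type*} {X : ℝ → Matrix ι (Fin 2) ℂ}
    {Y : ℝ → Matrix κ (Fin 2) ℂ} {x : ι → PairL2} {y : κ → PairL2}
    (hX : ∀ i, Represents (fun ω => X ω i) (x i)) (hY : ∀ j, Represents (fun ω => Y ω j) (y j)) :
    innerProd X Y = crossGram x y := by
  ext i j
  rw [innerProd_fin_two_apply X Y i j (hX i).continuous (hY j).continuous]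
  obtain ⟨A, B, k, hA, hB, h0, h1, hx⟩ := hX i
  obtain ⟨A', B', k', hA', hB', h0', h1', hy⟩ := hY j
  simp only [h0, h1, h0', h1', bracket_filtered_delays hA hA', bracket_filtered_delays hB hB',
    crossGram, Matrix.of_apply, hx, hy, inner_pairVec]

/-- Ψ_n itself is not causal, but its conjugated filter moves across the bracket and acts causally
on the rows of `Y`. -/
lemma innerProd_Psi_eq {F₅ : ℂ⟦X⟧} (h₅ : AbsSummable F₅) (n : ℕ) {κ : Type*}
    {Y : ℝ → Matrix κ (Fin 2) ℂ} {y : κ → PairL2}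
    (hY : ∀ j, Represents (fun ω => Y ω j) (y j)) :
    innerProd (Psi F₅ n) Y
      = toeplitz F₅ n * crossGram (fun k : Fin n => firstChannel (unitVec k)) y := by
  ext k j
  have hc : ∀ l, Continuous fun ω => Psi F₅ n ω k l := by
    intro l
    fin_cases l
    · simp only [Fin.zero_eta, Psi, delayVec_eq]
      exact h₅.continuous_freqResp.star.mul (continuous_unitDelay.pow ((k : ℕ) + 1))
    · exact continuous_const
  rw [innerProd_fin_two_apply _ Y k j hc (hY j).continuous]
  obtain ⟨A, B, m, hA, hB, h0, h1, hy⟩ := hY j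
  have e0 : (fun ω => Psi F₅ n ω k 0)
      = fun ω => star (freqResp F₅ ω) * unitDelay ω ^ ((k : ℕ) + 1) := by
    ext ω; simp [Psi, delayVec_eq]
  have e1 : bracket (fun ω => Psi F₅ n ω k 1) (fun ω => Y ω j 1) = 0 := by
    simp [Psi, bracket]
  rw [e1, e0, add_zero]
  simp only [h0]
  rw [bracket_star_filtered h₅ hA, inner_filterOp_unitVec h₅, Matrix.mul_apply]
  simp only [crossGram, Matrix.of_apply, hy, inner_pairVec_firstChannel]

lemma absSummable_zero : AbsSummable 0 := by simp [AbsSummable, summable_zero]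

lemma filterOp_zero : filterOp 0 = 0 := by simp [filterOp, evalAt]

lemma represents_Omega {F₁ F₂ F₃ F₄ : ℂ⟦X⟧} (h₁ : AbsSummable F₁) (h₂ : AbsSummable F₂)
    (h₃ : AbsSummable F₃) (h₄ : AbsSummable F₄) (n : ℕ) (i : Fin n ⊕ Fin n) :
    Represents (fun ω => Omega F₁ F₂ F₃ F₄ n ω i) (omegaRow F₁ F₂ F₃ F₄ n i) := by
  rcases i with k | k
  · refine ⟨F₁, F₂, k, h₁, h₂, fun ω => ?_, fun ω => ?_, ?_⟩
    · simp [Omega, delayVec_eq]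
    · simp [Omega, delayVec_eq]
    · simp [omegaRow, omegaMap_apply]
  · refine ⟨F₃, F₂ * F₄, k, h₃, h₂.mul h₄, fun ω => ?_, fun ω => ?_, ?_⟩
    · simp [Omega, delayVec_eq]
    · simp [Omega, delayVec_eq, freqResp_mul h₂ h₄]
    · simp [omegaRow, omegaMap_apply, filterOp_mul_apply h₂ h₄]

/-- The coefficient signals of the first column of `γ`. -/
def gamSignal (F₆ F₇ : ℂ⟦X⟧) (mf ml : ℕ) : Fin mf ⊕ Fin ml → SeqL2 :=
  Sum.elim (fun k => filterOp F₆ (unitVec k)) (fun k => filterOp F₇ (unitVec k))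

lemma represents_gam {F₆ F₇ : ℂ⟦X⟧} (h₆ : AbsSummable F₆) (h₇ : AbsSummable F₇) (mf ml : ℕ)
    (i : Fin mf ⊕ Fin ml) :
    Represents (fun ω => gam F₆ F₇ mf ml ω i) (firstChannel (gamSignal F₆ F₇ mf ml i)) := by
  rcases i with k | k
  · refine ⟨F₆, 0, k, h₆, absSummable_zero, fun ω => ?_, fun ω => ?_, ?_⟩
    · simp [gam, delayVec_eq]
    · simp [gam, freqResp]
    · simp [gamSignal, firstChannel_apply, filterOp_zero]
  · refine ⟨F₇, 0, k, h₇, absSummable_zero, fun ω => ?_, fun ω => ?_, ?_⟩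
    · simp [gam, delayVec_eq]
    · simp [gam, freqResp]
    · simp [gamSignal, firstChannel_apply, filterOp_zero]

end Representation

/-! ### Invertibility from the singular value bound, and the theorem -/

lemma isUnit_of_sigmaMin_pos {ι : Type*} [Fintype ι] [DecidableEq ι] [Nonempty ι]
    {A : Matrix ι ι ℂ} (h : 0 < sigmaMin A) : IsUnit A := by
  have h1 : Function.Injective (Matrix.toEuclideanLin A) := by
    rw [LinearMap.injective_iff_forall_lt_finrank_singularValues_pos]
    intro i hi
    rw [finrank_euclideanSpace] at hi
    exact h.trans_le ((Matrix.toEuclideanLin A).singularValues_antitone (by omega))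
  rw [← Matrix.mulVec_injective_iff_isUnit]
  intro v w hvw
  have := @h1 (WithLp.toLp 2 v) (WithLp.toLp 2 w) (by simpa using hvw)
  simpa using this

end
end GeometricVariance

theorem theorem2
    (F₁ F₂ F₃ F₄ F₅ F₆ F₇ : ℂ⟦X⟧) (mf ml : ℕ)
    (h₁ : ExpStable F₁) (h₂ : ExpStable F₂) (h₃ : ExpStable F₃) (h₄ : ExpStable F₄)
    (h₅ : ExpStable F₅) (h₆ : ExpStable F₆) (h₇ : ExpStable F₇)
    (hF₄ : PowerSeries.coeff 0 F₄ ≠ 0)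
    (hinv : HasExpStableInv (F₃ - F₁ * F₄))
    (hinv₅ : HasExpStableInv F₅)
    (hσ : ∃ c : ℝ, 0 < c ∧ ∃ n₀ : ℕ, ∀ n : ℕ, n₀ < n →
      c < sigmaMin (innerProd (Omega F₁ F₂ F₃ F₄ n) (Omega F₁ F₂ F₃ F₄ n))) :
    (∀ᶠ n : ℕ in atTop,
      IsUnit (innerProd (Omega F₁ F₂ F₃ F₄ n) (Omega F₁ F₂ F₃ F₄ n)) ∧
      IsUnit (innerProjection (Psi F₅ n) (Omega F₁ F₂ F₃ F₄ n))) ∧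
    Tendsto
      (fun n : ℕ =>
        innerProd (gam F₆ F₇ mf ml) (Psi F₅ n) *
          (innerProjection (Psi F₅ n) (Omega F₁ F₂ F₃ F₄ n))⁻¹ *
          innerProd (Psi F₅ n) (gam F₆ F₇ mf ml))
      atTop
      (𝓝 (innerProd (gam F₆ F₇ mf ml) (gam F₆ F₇ mf ml))) := by
  replace h₁ := h₁.absSummable
  replace h₂ := h₂.absSummable
  replace h₃ := h₃.absSummable
  replace h₄ := h₄.absSummable
  replace h₅ := h₅.absSummable
  obtain ⟨G, hG1, hG⟩ := hinv
  obtain ⟨G₅, hG₅1, hG₅⟩ := hinv₅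
  obtain ⟨c, hc, n₀, hσ⟩ := hσ
  have hΩ := represents_Omega h₁ h₂ h₃ h₄
  have hγ := represents_gam h₆.absSummable h₇.absSummable mf ml
  set u : ℕ → PairL2 := fun k => firstChannel (unitVec k)
  set w := omegaRow F₁ F₂ F₃ F₄
  set P := omegaSpan F₁ F₂ F₃ F₄
  set g := fun i => firstChannel (gamSignal F₆ F₇ mf ml i) with hg
  have hA : ∀ n, n₀ < n → IsUnit (crossGram (w n) (w n)) := fun n hn => by
    rw [← innerProd_eq_crossGram (hΩ n) (hΩ n)]
    have : Nonempty (Fin n ⊕ Fin n) := ⟨Sum.inl ⟨0, by omega⟩⟩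
    exact isUnit_of_sigmaMin_pos (hc.trans (hσ n hn))
  obtain ⟨δ, hδ, hlow⟩ := exists_le_norm_starProjection_omegaSpan (F₂ := F₂) h₁ h₃ h₄
    hG.absSummable hG1
  set K := fun n : ℕ => crossGram (fun k : Fin n => (P n).starProjection (u k))
    (fun k : Fin n => u k)
  have hKunit : ∀ n, IsUnit (K n) := fun n => isUnit_crossGram_starProjection
    (orthonormal_firstChannel_unitVec.comp _ Fin.val_injective).linearIndependent hδ (hlow n)
  set T := toeplitz F₅
  have hTunit : ∀ n, IsUnit (T n) := isUnit_toeplitz h₅ hG₅.absSummable hG₅1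
  -- Congruence by T_n isolates all dependence on F₅.
  have hproj : ∀ n, n₀ < n → innerProjection (Psi F₅ n) (Omega F₁ F₂ F₃ F₄ n)
      = T n * K n * (T n).conjTranspose := fun n hn => by
    have hKn : _ = K n :=
      crossGram_starProjection (P n) (w n) (fun k : Fin n => u k) rfl (hA n hn)
    rw [innerProjection, ← innerProd_conjTranspose (Psi F₅ n), innerProd_Psi_eq h₅ n (hΩ n),
      innerProd_eq_crossGram (hΩ n) (hΩ n), Matrix.conjTranspose_mul, crossGram_conjTranspose,
      ← hKn]
    simp only [Matrix.mul_assoc]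
    rfl
  have hTstar : ∀ n, IsUnit (T n).conjTranspose := fun n => (hTunit n).star
  refine ⟨?_, ?_⟩
  · filter_upwards [eventually_gt_atTop n₀] with n hn
    refine ⟨?_, ?_⟩
    · rw [innerProd_eq_crossGram (hΩ n) (hΩ n)]
      exact hA n hn
    · rw [hproj n hn]
      exact ((hTunit n).mul (hKunit n)).mul (hTstar n)
  · rw [innerProd_eq_crossGram hγ hγ]
    refine (tendsto_crossGram_mul_inv_mul P orthonormal_firstChannel_unitVec hδ hlow g
      (fun i => tendsto_starProjection_omegaSpan h₁ h₃ h₄ hG.absSummable hG1 _)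
      (fun i => ?_)).congr' ?_
    · simp only [hg, sum_inner_firstChannel_smul]
      exact (firstChannel.continuous.tendsto _).comp (tendsto_trunc _)
    · filter_upwards [eventually_gt_atTop n₀] with n hn
      -- The outer factors of ⟨γ, Ψ_n⟩ and ⟨Ψ_n, γ⟩ cancel those of the inverse.
      have hd := (Matrix.isUnit_iff_isUnit_det _).1 (hTunit n)
      have hd' := (Matrix.isUnit_iff_isUnit_det _).1 (hTstar n)
      rw [hproj n hn, ← innerProd_conjTranspose (Psi F₅ n), innerProd_Psi_eq h₅ n hγ,
        Matrix.conjTranspose_mul, crossGram_conjTranspose, Matrix.mul_inv_rev, Matrix.mul_inv_rev]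
      simp only [Matrix.mul_assoc]
      rw [Matrix.nonsing_inv_mul_cancel_left _ _ hd, Matrix.mul_nonsing_inv_cancel_left _ _ hd']
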